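/- Let $\mathcal W\subseteq\mathbb R^n$ be open and convex with $\mathbb R^n_+=\{x\in\mathbb R^n: x_i\ge 0 \text{ for all } i\}\subseteq\mathcal W$, let $f,g$ be continuously differentiable vector fields on $\mathcal W$ with values in $\mathbb R^n$, let $\tau_{\max}\ge 0$, and for $1\le i,j\le n$ let $\tau^i_j:[0,\infty)\to[0,\tau_{\max}]$ be continuous. Consider the delay system $$\dot x_i(t)=f_i(x(t))+g_i\bigl(x_1(t-\tau^i_1(t)),\dots,x_n(t-\tau^i_n(t))\bigr),\quad t\ge 0,\qquad x(t)=\varphi(t),\quad t\in[-\tau_{\max},0],\qquad (1)$$ for $i=1,\dots,n$. For vectors, $x\le y$ (resp. $x<y$) means $x_i\le y_i$ (resp. $x_i<y_i$) for all $i$. Suppose that $f$ is cooperative on $\mathbb R^n_+$, that is, $\frac{\partial f_i}{\partial x_j}(a)\ge 0$ for all $i\ne j$ and all $a\in\mathbb R^n_+$; that $g$ is order-preserving on $\mathbb R^n_+$, that is, $x\le y$ implies $g(x)\le g(y)$ for all $x,y\in\mathbb R^n_+$; and that (1) is positive, that is, solutions with initial function $\varphi\in C([-\tau_{\max},0],\mathbb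 R^n_+)$ remain in $\mathbb R^n_+$ for all $t\ge 0$. Suppose that (1) has a globally asymptotically stable equilibrium $x^\star\in\mathbb R^n_+$: that is, $f(x^\star)+g(x^\star)=0$; for every $\varphi\in C([-\tau_{\max},0],\mathbb R^n_+)$ the solution $x(t,\varphi)$ exists for all $t\ge 0$ and $x(t,\varphi)\to x^\star$ as $t\to\infty$; and for every $\varepsilon>0$ there is $\delta>0$ such that every $\varphi\in C([-\tau_{\max},0],\mathbb R^n_+)$ with $\|\varphi(t)-x^\star\|<\delta$ for all $t\in[-\tau_{\max},0]$ satisfies $\|x(t,\varphi)-x^\star\|<\varepsilon$ for all $t\ge 0$. Then: (a) There does not exist a vector $w\ne x^\star$ such that $w\ge x^\star$ and $f(w)+g(w)\ge 0$. (b) There exists a vector $v>0$ such that $v>x^\star$ and $f(v)+g(v)<0$. -/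

import Mathlib

open Set Filter Topology

/-- The closed non-negative orthant of `ℝⁿ`; `≤` on vectors is the componentwise order. -/
def orthant (n : ℕ) : Set (Fin n → ℝ) := {x | 0 ≤ x}

/-- A real square matrix is Metzler if its off-diagonal entries are non-negative. -/
def IsMetzler {n : ℕ} (A : Matrix (Fin n) (Fin n) ℝ) : Prop :=
  ∀ i j, i ≠ j → 0 ≤ A i j

/-- The Jacobian matrix of `f` at `a`: the entry `(i, j)` is the partial derivative of `f i` with
respect to the `j`-th coordinate. -/
noncomputable def jacobian {n : ℕ} (f : (Fin n → ℝ) → (Fin n → ℝ)) (a : Fin n → ℝ) :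
    Matrix (Fin n) (Fin n) ℝ :=
  Matrix.of fun i j => fderiv ℝ f a (Pi.single j 1) i

/-- `f` is cooperative on `D`: at every point of `D` it is continuously differentiable (in a
neighbourhood of the point in `ℝⁿ`) and its Jacobian matrix is Metzler. -/
def IsCooperativeOn {n : ℕ} (f : (Fin n → ℝ) → (Fin n → ℝ)) (D : Set (Fin n → ℝ)) : Prop :=
  ∀ a ∈ D, ContDiffAt ℝ 1 f a ∧ IsMetzler (jacobian f a)

/-- The data of a system with bounded heterogeneous time-varying delays
`xᵢ'(t) = fᵢ(x(t)) + gᵢ(x₁(t - τᵢ₁(t)), …, xₙ(t - τᵢₙ(t)))`, `t ≥ 0`,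
with its standing assumptions. -/
structure DelaySystem (n : ℕ) where
  /-- the open convex state domain -/
  W : Set (Fin n → ℝ)
  isOpen_W : IsOpen W
  convex_W : Convex ℝ W
  f : (Fin n → ℝ) → (Fin n → ℝ)
  g : (Fin n → ℝ) → (Fin n → ℝ)
  contDiffOn_f : ContDiffOn ℝ 1 f W
  contDiffOn_g : ContDiffOn ℝ 1 g W
  /-- the bound on the delays -/
  τmax : ℝ
  τmax_nonneg : 0 ≤ τmax
  /-- `τ i j` is the delay of the `j`-th component in the `i`-th equation -/
  τ : Fin n → Fin n → ℝ → ℝ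
  continuousOn_τ : ∀ i j, ContinuousOn (τ i j) (Ici 0)
  τ_mem : ∀ i j, ∀ t, 0 ≤ t → τ i j t ∈ Icc 0 τmax

namespace DelaySystem

variable {n : ℕ} (S : DelaySystem n)

/-- The vector `(x₁(t - τᵢ₁(t)), …, xₙ(t - τᵢₙ(t)))` entering the `i`-th equation. -/
def delayed (x : ℝ → Fin n → ℝ) (i : Fin n) (t : ℝ) : Fin n → ℝ :=
  fun j => x (t - S.τ i j t) j

/-- `x` is a solution on `[-τmax, ∞)` with initial function `φ` on `[-τmax, 0]`. The derivative is
two-sided at `t > 0` and one-sided at `t = 0`; the vectors at which `f` and `g` are evaluated are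
required to lie in `W`. Values of `x` before `-τmax` and of `φ` outside `[-τmax, 0]` play no
role. -/
structure IsSolution (φ x : ℝ → Fin n → ℝ) : Prop where
  initial : ∀ t ∈ Icc (-S.τmax) 0, x t = φ t
  continuousOn : ContinuousOn x (Ici (-S.τmax))
  mem : ∀ t, 0 ≤ t → x t ∈ S.W
  delayed_mem : ∀ t, 0 ≤ t → ∀ i, S.delayed x i t ∈ S.W
  hasDeriv : ∀ t, 0 ≤ t → ∀ i,
    HasDerivWithinAt (fun s => x s i) (S.f (x t) i + S.g (S.delayed x i t) i) (Ici 0) t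

/-- `φ` is a continuous function from `[-τmax, 0]` to the non-negative orthant. -/
def IsNonnegInitial (φ : ℝ → Fin n → ℝ) : Prop :=
  ContinuousOn φ (Icc (-S.τmax) 0) ∧ ∀ t ∈ Icc (-S.τmax) 0, φ t ∈ orthant n

/-- The system is positive: trajectories with non-negative initial functions stay
non-negative. -/
def IsPositive : Prop :=
  ∀ φ x, S.IsNonnegInitial φ → S.IsSolution φ x → ∀ t, 0 ≤ t → x t ∈ orthant n

/-- `p` is an equilibrium. -/
def IsEquilibrium (p : Fin n → ℝ) : Prop :=
  p ∈ S.W ∧ S.f p + S.g p = 0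

/-- `p` is a globally asymptotically stable equilibrium in the non-negative orthant, with respect
to all non-negative initial functions: solutions exist for all time, `p` is stable in the sense of
Lyapunov, and every solution converges to `p`. -/
structure IsGAS (p : Fin n → ℝ) : Prop where
  mem_orthant : p ∈ orthant n
  isEquilibrium : S.IsEquilibrium p
  exists_solution : ∀ φ, S.IsNonnegInitial φ → ∃ x, S.IsSolution φ x
  stable : ∀ ε > 0, ∃ δ > 0, ∀ φ x, S.IsNonnegInitial φ → S.IsSolution φ x →
    (∀ t ∈ Icc (-S.τmax) 0, ‖φ t - p‖ < δ) → ∀ t, 0 ≤ t → ‖x t - p‖ < ε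
  attractive : ∀ φ x, S.IsNonnegInitial φ → S.IsSolution φ x → Tendsto x atTop (𝓝 p)

end DelaySystem

/-! For (a), comparison does the work: if `0 ≤ f w + g w`, the solution started from the constant
`w` never drops below `w` (`ge_of_subequilibrium`). It converges to `p`, so `w ≤ p`, and `p ≤ w`
forces `w = p`. Part (b) follows from (a) without further dynamics (`exists_neg_of_quasimonotone`).
The field `F = f + g` is quasimonotone, and (a) with compactness gives `c > 0` such that the part of
the box `[p, p + 1]` where `F ≥ -c` misses the outer faces. A point of that part with maximal
coordinate sum satisfies `F = -c` in every component, since otherwise one coordinate could still be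
raised. -/

/-- A cooperative vector field is quasimonotone: raising the other coordinates raises its `i`-th
component. -/
theorem IsCooperativeOn.quasimonotone {n : ℕ} {f : (Fin n → ℝ) → (Fin n → ℝ)}
    (hf : IsCooperativeOn f (orthant n)) {a b : Fin n → ℝ} (ha : a ∈ orthant n) (hab : a ≤ b)
    {i : Fin n} (hi : a i = b i) : f a i ≤ f b i := by
  have hmem : ∀ s ∈ Icc (0 : ℝ) 1, a + s • (b - a) ∈ orthant n := fun s hs =>
    add_nonneg ha (smul_nonneg hs.1 (sub_nonneg.2 hab))
  have hderiv : ∀ s ∈ Icc (0 : ℝ) 1, HasDerivAt (fun s : ℝ => f (a + s • (b - a)) i)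
      (fderiv ℝ f (a + s • (b - a)) (b - a) i) s := by
    intro s hs
    have h1 : HasDerivAt (fun s : ℝ => a + s • (b - a)) (b - a) s := by
      simpa using ((hasDerivAt_id s).smul_const (b - a)).const_add a
    have h2 := ((hf _ (hmem s hs)).1.differentiableAt one_ne_zero).hasFDerivAt
    exact hasDerivAt_pi.1 (h2.comp_hasDerivAt s h1) i
  -- The diagonal entry of the Jacobian has no sign, but it is multiplied by `b i - a i = 0`.
  have hnonneg : ∀ s ∈ Icc (0 : ℝ) 1, 0 ≤ fderiv ℝ f (a + s • (b - a)) (b - a) i := by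
    intro s hs
    have hsum : b - a = ∑ j, (b j - a j) • (Pi.single j (1 : ℝ) : Fin n → ℝ) := by
      ext k
      simp [Finset.sum_apply, Pi.single_apply]
    rw [hsum, map_sum, ← hsum, Finset.sum_apply]
    refine Finset.sum_nonneg fun j _ => ?_
    rw [map_smul, Pi.smul_apply, smul_eq_mul]
    by_cases hij : i = j
    · subst hij
      simp [hi]
    · exact mul_nonneg (sub_nonneg.2 (hab j)) ((hf _ (hmem s hs)).2 i j hij)
  have hmono : MonotoneOn (fun s : ℝ => f (a + s • (b - a)) i) (Icc 0 1) :=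
    monotoneOn_of_deriv_nonneg (convex_Icc 0 1)
      (fun s hs => (hderiv s hs).continuousAt.continuousWithinAt)
      (fun s hs => (hderiv s (interior_subset hs)).differentiableAt.differentiableWithinAt)
      (fun s hs => by
        rw [(hderiv s (interior_subset hs)).deriv]
        exact hnonneg s (interior_subset hs))
  simpa using hmono (left_mem_Icc.2 zero_le_one) (right_mem_Icc.2 zero_le_one) zero_le_one

/-- Let `F` be continuous and quasimonotone above a zero `p`. If no point above `p` other than `p`
satisfies `0 ≤ F`, then some point strictly above `p` satisfies `F < 0`. -/
theorem exists_neg_of_quasimonotone {n : ℕ} {F : (Fin n → ℝ) → (Fin n → ℝ)} {p : Fin n → ℝ}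
    (hcont : ContinuousOn F (Ici p))
    (hmono : ∀ a b i, p ≤ a → a ≤ b → a i = b i → F a i ≤ F b i) (hFp : F p = 0)
    (hno : ∀ w, p ≤ w → 0 ≤ F w → w = p) :
    ∃ v, (∀ i, p i < v i) ∧ ∀ i, F v i < 0 := by
  have hbox : Icc p (p + 1) ⊆ Ici p := fun x hx => hx.1
  have hcomp : ∀ i, ContinuousOn (fun x => F x i) (Icc p (p + 1)) := fun i =>
    (continuous_apply i).comp_continuousOn (hcont.mono hbox)
  -- a uniform gap on the outer faces of the box
  obtain ⟨c, hc, hgap⟩ : ∃ c > 0, ∀ x ∈ Icc p (p + 1), (∃ i, x i = p i + 1) →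
      ∃ i, F x i < -c := by
    -- Otherwise points of the outer faces with `F ≥ -1/(k+1)` accumulate at some `w` with `0 ≤ F
    -- w`. Then `w = p`, which lies away from those faces.
    by_contra! hcon
    choose x hx hface hF using fun k : ℕ => hcon (1 / ((k : ℝ) + 1)) (by positivity)
    obtain ⟨w, hw, φ, hφ, hlim⟩ := isCompact_Icc.tendsto_subseq hx
    have hlimF : ∀ i, Tendsto (fun k => F (x (φ k)) i) atTop (𝓝 (F w i)) := fun i =>
      (hcomp i w hw).tendsto.comp (tendsto_nhdsWithin_iff.2 ⟨hlim, .of_forall fun k => hx _⟩)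
    have hzero : Tendsto (fun k => -(1 / ((φ k : ℝ) + 1))) atTop (𝓝 0) := by
      simpa using ((tendsto_one_div_add_atTop_nhds_zero_nat (𝕜 := ℝ)).comp hφ.tendsto_atTop).neg
    have hwp : w = p := hno w hw.1 fun i =>
      le_of_tendsto_of_tendsto' hzero (hlimF i) fun k => hF (φ k) i
    have hnear : ∀ᶠ k in atTop, ∀ i, x (φ k) i < p i + 1 := by
      rw [eventually_all]
      intro i
      refine (tendsto_pi_nhds.1 hlim i).eventually_lt_const ?_
      simp [hwp]
    obtain ⟨k, hk⟩ := hnear.exists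
    obtain ⟨i, hi⟩ := hface (φ k)
    exact (hk i).ne hi
  have hclosed : IsClosed (Icc p (p + 1) ∩ ⋂ i, {x | x ∈ Icc p (p + 1) ∧ -c ≤ F x i}) := by
    refine isClosed_Icc.inter (isClosed_iInter fun i => ?_)
    exact (hcomp i).preimage_isClosed_of_isClosed isClosed_Icc isClosed_Ici
  have hcpt := isCompact_Icc.of_isClosed_subset hclosed inter_subset_left
  have hpbox : p ∈ Icc p (p + 1) := ⟨le_rfl, fun i => by simp⟩
  obtain ⟨v, ⟨hv, hvF⟩, hmax⟩ := hcpt.exists_isMaxOn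
    ⟨p, hpbox, mem_iInter.2 fun i => ⟨hpbox, by simp [hFp, hc.le]⟩⟩
    (f := fun x => ∑ i, x i) (by fun_prop)
  have hvF' : ∀ i, -c ≤ F v i := fun i => (mem_iInter.1 hvF i).2
  have hvlt : ∀ i, v i < p i + 1 := fun i => by
    refine lt_of_le_of_ne (hv.2 i) fun h => ?_
    obtain ⟨j, hj⟩ := hgap v hv ⟨i, h⟩
    exact hj.not_ge (hvF' j)
  -- If `F v i > -c`, a slight increase of `v i` alone keeps component `i` above `-c` by continuity
  -- and does not lower the others by quasimonotonicity, contradicting maximality of the sum.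
  have hFv : ∀ i, F v i = -c := by
    intro i
    refine le_antisymm (not_lt.1 fun hlt => ?_) (hvF' i)
    let y : ℝ → Fin n → ℝ := fun s => v + Pi.single i s
    have hy : Continuous y := by
      refine continuous_const.add (continuous_pi fun j => ?_)
      by_cases h : j = i
      · subst h; simpa using continuous_id'
      · simpa [Pi.single_apply, h] using continuous_const
    have hy0 : y 0 = v := by simp [y]
    have hyv : ∀ s, 0 ≤ s → v ≤ y s := fun s hs => by
      simpa [y] using hs
    have htend : Tendsto y (𝓝[>] 0) (𝓝[Ici p] v) := by
      refine tendsto_nhdsWithin_iff.2 ⟨?_, ?_⟩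
      · simpa [hy0] using (hy.tendsto 0).mono_left nhdsWithin_le_nhds
      · filter_upwards [self_mem_nhdsWithin] with s hs using hv.1.trans (hyv s (le_of_lt hs))
    have hFi : Tendsto (fun s => F (y s) i) (𝓝[>] 0) (𝓝 (F v i)) :=
      (tendsto_pi_nhds.1 (hcont v hv.1) i).comp htend
    have hyi : Tendsto (fun s => y s i) (𝓝[>] 0) (𝓝 (v i)) :=
      tendsto_pi_nhds.1 (htend.mono_right nhdsWithin_le_nhds) i
    obtain ⟨s, hFs, hys, hs⟩ := ((hFi.eventually_const_lt hlt).and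
      ((hyi.eventually_lt_const (hvlt i)).and self_mem_nhdsWithin)).exists
    have hs : 0 < s := hs
    have hyj : ∀ j, j ≠ i → y s j = v j := fun j hj => by simp [y, hj]
    have hybox : y s ∈ Icc p (p + 1) := by
      refine ⟨hv.1.trans (hyv s hs.le), fun j => ?_⟩
      by_cases hj : j = i
      · subst hj; exact hys.le
      · rw [hyj j hj]; exact hv.2 j
    have hle := hmax ⟨hybox, mem_iInter.2 fun j => ⟨hybox, ?_⟩⟩
    · have : ∑ j, y s j = ∑ j, v j + s := by
        simp [y, Finset.sum_add_distrib]
      simp only [mem_ofPred_eq] at hle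
      linarith
    · by_cases hj : j = i
      · subst hj; exact hFs.le
      · exact (hvF' j).trans (hmono v (y s) j hv.1 (hyv s hs.le) (hyj j hj).symm)
  -- If `v i = p i`, quasimonotonicity would give `0 = F p i ≤ F v i = -c`.
  refine ⟨v, fun i => lt_of_le_of_ne (hv.1 i) fun h => ?_, fun i => by rw [hFv i]; linarith⟩
  have := hmono p v i le_rfl hv.1 h
  rw [hFp, hFv i, Pi.zero_apply] at this
  linarith

/-- A function that is positive before `t` and non-positive at `t` cannot have a positive
derivative at `t`. -/
theorem hasDerivAt_nonpos_of_pos_left {z : ℝ → ℝ} {z' t : ℝ} (ht : 0 < t)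
    (hz : HasDerivAt z z' t) (hleft : ∀ s, 0 ≤ s → s < t → 0 < z s) (hzt : z t ≤ 0) :
    z' ≤ 0 := by
  have hslope : Tendsto (slope z t) (𝓝[<] t) (𝓝 z') :=
    (hasDerivAt_iff_tendsto_slope.1 hz).mono_left (nhdsWithin_mono t fun s hs => ne_of_lt hs)
  refine le_of_tendsto hslope ?_
  filter_upwards [self_mem_nhdsWithin, Ioo_mem_nhdsLT ht] with s hs hs0
  rw [slope_def_field]
  exact div_nonpos_of_nonneg_of_nonpos (by linarith [hleft s hs0.1.le hs]) (sub_nonpos.2 hs0.2.le)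

namespace DelaySystem

variable {n : ℕ} (S : DelaySystem n)

/-- A function that is `C¹` on the domain is Lipschitz on boxes of the non-negative orthant. -/
theorem exists_lipschitzOnWith_box (hW : orthant n ⊆ S.W) {h : (Fin n → ℝ) → (Fin n → ℝ)}
    (hh : ContDiffOn ℝ 1 h S.W) (r : Fin n → ℝ) : ∃ K, LipschitzOnWith K h (Icc 0 r) := by
  refine LocallyLipschitzOn.exists_lipschitzOnWith_of_compact isCompact_Icc fun x hx => ?_
  obtain ⟨K, t, ht, hK⟩ :=
    (hh.contDiffAt (S.isOpen_W.mem_nhds (hW hx.1))).exists_lipschitzOnWith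
  exact ⟨K, t, mem_nhdsWithin_of_mem_nhds ht, hK⟩

/-- Changing a vector to its supremum with `w` moves the components of a Lipschitz field by at most
the Lipschitz constant times the defect. -/
theorem sub_le_of_lipschitzOnWith {h : (Fin n → ℝ) → (Fin n → ℝ)} {K : NNReal} {r w y : Fin n → ℝ}
    (hh : LipschitzOnWith K h (Icc 0 r)) (hw : w ∈ Icc 0 r) (hy : y ∈ Icc 0 r) {δ : ℝ}
    (hδ : 0 ≤ δ) (hwy : ∀ j, w j - δ ≤ y j) (i : Fin n) : h (y ⊔ w) i - K * δ ≤ h y i := by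
  have hmem : y ⊔ w ∈ Icc 0 r := ⟨hy.1.trans le_sup_left, sup_le hy.2 hw.2⟩
  have h1 := hh.dist_le_mul _ hmem _ hy
  have h2 : dist (y ⊔ w) y ≤ δ := by
    refine (dist_pi_le_iff hδ).2 fun j => ?_
    rw [Real.dist_eq, Pi.sup_apply, abs_of_nonneg (sub_nonneg.2 le_sup_left), sub_le_iff_le_add]
    exact sup_le (by linarith) (by linarith [hwy j])
  have h3 := (dist_le_pi_dist (h (y ⊔ w)) (h y) i).trans
    (h1.trans (mul_le_mul_of_nonneg_left h2 K.2))
  rw [Real.dist_eq] at h3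
  linarith [le_abs_self (h (y ⊔ w) i - h y i)]

variable {S}

/-- If `0 ≤ f w + g w`, then the solution starting from the constant `w` stays above `w`. -/
theorem IsSolution.ge_of_subequilibrium (hW : orthant n ⊆ S.W)
    (hf : IsCooperativeOn S.f (orthant n)) (hg : MonotoneOn S.g (orthant n)) (hpos : S.IsPositive)
    {w : Fin n → ℝ} (hw : w ∈ orthant n) (hFw : 0 ≤ S.f w + S.g w) {x : ℝ → Fin n → ℝ}
    (hx : S.IsSolution (fun _ => w) x) {T : ℝ} (hT : 0 ≤ T) : w ≤ x T := by
  have hτ := S.τmax_nonneg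
  have hxorth : ∀ t, -S.τmax ≤ t → 0 ≤ x t := by
    intro t ht
    rcases le_total 0 t with h | h
    · exact hpos _ x ⟨continuousOn_const, fun _ _ => hw⟩ hx t h
    · rw [hx.initial t ⟨ht, h⟩]; exact hw
  obtain ⟨r, hwr, hxr⟩ : ∃ r : Fin n → ℝ, w ≤ r ∧ ∀ t ∈ Icc (-S.τmax) T, x t ≤ r := by
    obtain ⟨r, hr⟩ := (isCompact_Icc.image_of_continuousOn
      (hx.continuousOn.mono (Icc_subset_Ici_self : Icc (-S.τmax) T ⊆ _))).isBounded.bddAbove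
    exact ⟨r ⊔ w, le_sup_right, fun t ht => (hr (mem_image_of_mem x ht)).trans le_sup_left⟩
  obtain ⟨K, hK⟩ := S.exists_lipschitzOnWith_box hW S.contDiffOn_f r
  obtain ⟨K', hK'⟩ := S.exists_lipschitzOnWith_box hW S.contDiffOn_g r
  have hwbox : w ∈ Icc 0 r := ⟨hw, hwr⟩
  have hxbox : ∀ t ∈ Icc (-S.τmax) T, x t ∈ Icc 0 r := fun t ht => ⟨hxorth t ht.1, hxr t ht⟩
  -- The barrier `w - ε exp(L t)` must fall faster than the Lipschitz losses `K` and `K'` can pull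
  -- the solution down; the extra `1` makes this strict.
  set L : ℝ := K + K' + 1 with hL
  have hL0 : 0 ≤ L := by positivity
  have hbarrier : ∀ ε > 0, ∀ t ∈ Icc 0 T, ∀ i, 0 < x t i - w i + ε * Real.exp (L * t) := by
    intro ε hε
    by_contra! hcon
    have hzc : ∀ i, ContinuousOn (fun t => x t i - w i + ε * Real.exp (L * t)) (Icc 0 T) := by
      intro i
      have : ContinuousOn (fun t => x t i) (Icc 0 T) :=
        (continuous_apply i).comp_continuousOn
          (hx.continuousOn.mono fun t ht => (neg_nonpos.2 hτ).trans ht.1)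
      fun_prop
    have hBc : IsCompact (⋃ i, {t | t ∈ Icc 0 T ∧ x t i - w i + ε * Real.exp (L * t) ≤ 0}) :=
      isCompact_iUnion fun i => isCompact_Icc.of_isClosed_subset
        ((hzc i).preimage_isClosed_of_isClosed isClosed_Icc isClosed_Iic) inter_subset_left
    obtain ⟨t', ht', i', hi'⟩ := hcon
    -- `t` is the first time at which some component meets the barrier.
    obtain ⟨t, ht, hmin⟩ := hBc.exists_isLeast ⟨t', mem_iUnion.2 ⟨i', ht', hi'⟩⟩
    obtain ⟨i, htT, hzt⟩ := mem_iUnion.1 ht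
    have hbefore : ∀ s, 0 ≤ s → s < t → ∀ j, 0 < x s j - w j + ε * Real.exp (L * s) := by
      intro s hs hst j
      by_contra! h
      exact hst.not_ge (hmin (mem_iUnion.2 ⟨j, ⟨hs, hst.le.trans htT.2⟩, h⟩))
    have hx0 : x 0 = w := hx.initial 0 ⟨neg_nonpos.2 hτ, le_rfl⟩
    have ht0 : 0 < t := by
      refine lt_of_le_of_ne htT.1 fun h => ?_
      rw [← h, hx0, mul_zero, Real.exp_zero] at hzt
      linarith
    have hat : ∀ j, 0 ≤ x t j - w j + ε * Real.exp (L * t) := by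
      intro j
      have hlim : Tendsto (fun s => x s j - w j + ε * Real.exp (L * s)) (𝓝[<] t)
          (𝓝 (x t j - w j + ε * Real.exp (L * t))) :=
        ((hzc j) t htT).tendsto.mono_left (nhdsWithin_le_iff.2 (mem_of_superset
          (Ioo_mem_nhdsLT ht0) fun s hs => ⟨hs.1.le, hs.2.le.trans htT.2⟩))
      refine ge_of_tendsto hlim ?_
      filter_upwards [Ioo_mem_nhdsLT ht0] with s hs using (hbefore s hs.1.le hs.2 j).le
    set δ := ε * Real.exp (L * t) with hδ
    have hδ0 : 0 < δ := by positivity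
    -- The defect allowed by the barrier grows with time, so `δ` bounds it over the whole past and
    -- the delays are harmless.
    have hlow : ∀ s, -S.τmax ≤ s → s ≤ t → ∀ j, w j - δ ≤ x s j := by
      intro s hs hst j
      rcases le_total s 0 with h | h
      · rw [hx.initial s ⟨hs, h⟩]; linarith
      · rcases hst.eq_or_lt with rfl | hst'
        · linarith [hat j]
        · have : ε * Real.exp (L * s) ≤ δ := by rw [hδ]; gcongr
          linarith [hbefore s h hst' j]
    have hfi : S.f w i - K * δ ≤ S.f (x t) i := by
      have h1 := sub_le_of_lipschitzOnWith hK hwbox (hxbox t ⟨by linarith, htT.2⟩) hδ0.le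
        (hlow t (by linarith) le_rfl) i
      -- At contact `x t i ≤ w i`, so the supremum agrees with `w` in coordinate `i`.
      have h2 : S.f w i ≤ S.f (x t ⊔ w) i :=
        hf.quasimonotone hw le_sup_right (sup_eq_right.2 (by linarith)).symm
      linarith
    have hgi : S.g w i - K' * δ ≤ S.g (S.delayed x i t) i := by
      have hτt := fun j => S.τ_mem i j t htT.1
      have hdbox : S.delayed x i t ∈ Icc 0 r :=
        ⟨fun j => (hxbox _ ⟨by linarith [(hτt j).2], by linarith [(hτt j).1, htT.2]⟩).1 j,
          fun j => (hxbox _ ⟨by linarith [(hτt j).2], by linarith [(hτt j).1, htT.2]⟩).2 j⟩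
      have h1 := sub_le_of_lipschitzOnWith hK' hwbox hdbox hδ0.le (fun j =>
        hlow (t - S.τ i j t) (by linarith [(hτt j).2]) (by linarith [(hτt j).1]) j) i
      have h2 : S.g w i ≤ S.g (S.delayed x i t ⊔ w) i :=
        hg hw (hw.trans le_sup_right : (0 : Fin n → ℝ) ≤ _) le_sup_right i
      linarith
    have hder : HasDerivAt (fun s => x s i - w i + ε * Real.exp (L * s))
        (S.f (x t) i + S.g (S.delayed x i t) i + δ * L) t := by
      have h1 := (hx.hasDeriv t htT.1 i).hasDerivAt (Ici_mem_nhds ht0)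
      have h2 : HasDerivAt (fun s => ε * Real.exp (L * s)) (δ * L) t := by
        have := (((hasDerivAt_id t).const_mul L).exp).const_mul ε
        simpa [hδ, mul_assoc] using this
      exact (h1.sub_const (w i)).add h2
    -- The derivative is at least `L * δ - (K + K') * δ = δ > 0`, yet first contact makes it
    -- non-positive.
    have hle := hasDerivAt_nonpos_of_pos_left ht0 hder (fun s hs hst => hbefore s hs hst i) hzt
    have hFi : 0 ≤ S.f w i + S.g w i := hFw i
    have : (K + K') * δ + δ = δ * L := by rw [hL]; ring
    linarith
  intro i
  have hlim : Tendsto (fun ε : ℝ => x T i - w i + ε * Real.exp (L * T)) (𝓝[>] 0)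
      (𝓝 (x T i - w i)) := by
    have : Continuous fun ε : ℝ => x T i - w i + ε * Real.exp (L * T) := by fun_prop
    simpa using (this.tendsto 0).mono_left nhdsWithin_le_nhds
  refine sub_nonneg.1 (ge_of_tendsto hlim ?_)
  filter_upwards [self_mem_nhdsWithin] with ε hε using (hbarrier ε hε T ⟨hT, le_rfl⟩ i).le

end DelaySystem

theorem lemma1 {n : ℕ} (S : DelaySystem n) (hW : orthant n ⊆ S.W)
    (hf : IsCooperativeOn S.f (orthant n)) (hg : MonotoneOn S.g (orthant n))
    (hpos : S.IsPositive) (p : Fin n → ℝ) (hp : S.IsGAS p) :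
    (¬ ∃ w : Fin n → ℝ, w ≠ p ∧ p ≤ w ∧ 0 ≤ S.f w + S.g w) ∧
    (∃ v : Fin n → ℝ, (∀ i, 0 < v i) ∧ (∀ i, p i < v i) ∧ ∀ i, S.f v i + S.g v i < 0) := by
  have hp0 : 0 ≤ p := hp.mem_orthant
  have hno : ∀ w, p ≤ w → 0 ≤ S.f w + S.g w → w = p := by
    intro w hpw hFw
    have hw : w ∈ orthant n := hp0.trans hpw
    have hinit : S.IsNonnegInitial fun _ => w := ⟨continuousOn_const, fun _ _ => hw⟩
    obtain ⟨x, hx⟩ := hp.exists_solution _ hinit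
    refine le_antisymm (ge_of_tendsto (hp.attractive _ x hinit hx) ?_) hpw
    filter_upwards [eventually_ge_atTop 0] with t ht
      using hx.ge_of_subequilibrium hW hf hg hpos hw hFw ht
  refine ⟨fun ⟨w, hne, hpw, hFw⟩ => hne (hno w hpw hFw), ?_⟩
  have hsub : Ici p ⊆ S.W := fun x hx => hW (hp0.trans hx)
  obtain ⟨v, hpv, hFv⟩ := exists_neg_of_quasimonotone (F := S.f + S.g)
    ((S.contDiffOn_f.continuousOn.add S.contDiffOn_g.continuousOn).mono hsub)
    (fun a b i hpa hab hi => add_le_add (hf.quasimonotone (hp0.trans hpa) hab hi)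
      (hg (hp0.trans hpa) ((hp0.trans hpa).trans hab) hab i))
    hp.isEquilibrium.2 hno
  exact ⟨v, fun i => (hp0 i).trans_lt (hpv i), hpv, hFv⟩
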